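/- **Notation.** Let $g\ge 2$, $N=g(g+1)/2$, and let $\mathcal H_g$ be the space of symmetric complex $g\times g$ matrices $\tau$ with positive definite imaginary part. For $\sigma\in\mathbb F_2^g$ (with entries lifted to $\{0,1\}$) let $$\Theta[\sigma](\tau,z)=\sum_{p\in\mathbb Z^g}\exp\Big(2\pi i\,(p+\tfrac{\sigma}{2})^t\tau(p+\tfrac{\sigma}{2})+4\pi i\,(p+\tfrac{\sigma}{2})^t z\Big),\qquad \Theta[\sigma](\tau)=\Theta[\sigma](\tau,0)$$ be the theta function and theta constant of second order. Put $\partial_{ij}=\tfrac12(1+\delta_{ij})\,\partial/\partial\tau_{ij}$, where $\tau_{ij}=\tau_{ji}$ $(i\le j)$ are the coordinates on $\mathcal H_g$, and $\partial=(\partial_{ij})$. For sets $I,J$ of the same size let $|\partial^I_J|=\det(\partial_{ij})_{i\in I,j\in J}$ as a differential operator (the identity if $I=J=\emptyset$). For $i\le j$ let $d\check\tau_{ij}=d\check\tau_{ji}=\pm\bigwedge_{h\le k,\,(h,k)\ne(i,j)}d\tau_{hk}$ with the sign for which $d\check\tau_{ij}\wedge d\tau_{ij}=\bigwedge_{h\le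 k}d\tau_{hk}$, and $\operatorname{tr}(B\,d\check\tau)=\sum_{i,j}B_{ij}\,d\check\tau_{ij}$. Freitag's pairing of holomorphic functions $f,h$ on $\mathcal H_g$ is the $(N-1)$-form $\{f,h\}=\operatorname{tr}(B^{f,h}\,d\check\tau)$ with $$B^{f,h}_{ij}=(-1)^{i+j}\sum_{k=0}^{g-1}\frac{(-1)^k}{\binom{g-1}{k}}\sum_{I,J}s(I)s(J)\,\big(|\partial^I_J|f\big)\big(|\partial^{I^c}_{J^c}|h\big),$$ where $I$ and $J$ run over the $k$-element subsets of $\{1,\dots,g\}\setminus\{i\}$ and of $\{1,\dots,g\}\setminus\{j\}$, complements are taken in these sets, and $s(I)$ is the sign of the permutation that sorts the sequence $I,I^c$ (each listed increasingly); similarly for $s(J)$. For $\varepsilon,\delta\in\mathbb F_2^g$ put $$A_{\varepsilon\delta}=4\pi i\,\big(\Theta[\varepsilon]\,\partial\Theta[\delta]-\Theta[\delta]\,\partial\Theta[\varepsilon]\big),\qquad (\widetilde A_{\varepsilon\delta})_{ij}=\big(\partial_{z_i}\partial_{z_j}\Theta[\delta]\big)\Theta[\varepsilon]-\big(\partial_{z_i}\partial_{z_j}\Theta[\varepsilon]\big)\Theta[\delta]\quad\text{at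 }z=0,$$ and let $M^{ad}$ denote the adjugate (transposed cofactor matrix) of $M$. **Theorem.** Let $\varepsilon\ne\delta$. The matrix $B^{f,h}$ for $f=\Theta[\varepsilon]^{g-1}$, $h=\Theta[\delta]^{g-1}$ is symmetric at every point of $\mathcal H_g$. If $B_{\varepsilon\delta}$ is any function on $\mathcal H_g$ with values in the symmetric matrices such that $\{\Theta[\varepsilon]^{g-1},\Theta[\delta]^{g-1}\}=\operatorname{tr}(B_{\varepsilon\delta}\,d\check\tau)$, then on $\mathcal H_g$ $$A_{\varepsilon\delta}^{ad}=\frac{(4\pi i)^{g-1}}{(g-1)!}\,B_{\varepsilon\delta}.$$ Moreover $\widetilde A_{\varepsilon\delta}=2A_{\varepsilon\delta}$, so that $\widetilde A_{\varepsilon\delta}^{ad}=\frac{(8\pi i)^{g-1}}{(g-1)!}B_{\varepsilon\delta}$; where $\Theta[\delta]\ne0$ one has $A_{\varepsilon\delta}=-4\pi i\,\Theta[\delta]^2\,\partial\big(\Theta[\varepsilon]/\Theta[\delta]\big)$; and $$\operatorname{tr}(A_{\varepsilon\delta}^{ad}\,d\check\tau)=\frac{(4\pi i)^{g-1}}{(g-1)!}\,\{\Theta[\varepsilon]^{g-1},\Theta[\delta]^{g-1}\}.$$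 -/

import Mathlib

open scoped BigOperators

noncomputable section

namespace SiegelTheta

/-- The Siegel upper half-space of degree `g`: symmetric complex matrices with positive definite
imaginary part. -/
def siegelUpperHalfSpace (g : ℕ) : Set (Matrix (Fin g) (Fin g) ℂ) :=
  {τ | τ.IsSymm ∧ (τ.map Complex.im).PosDef}

/-! ### Theta functions -/

/-- The half-integral vector `ε / 2`, for `ε` with entries `0, 1`. -/
def halfChar {g : ℕ} (ε : Fin g → ZMod 2) : Fin g → ℂ := fun i => ((ε i).val : ℂ) / 2

/-- The theta function with characteristic `[ε, δ]`. -/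
def theta {g : ℕ} (ε δ : Fin g → ZMod 2) (τ : Matrix (Fin g) (Fin g) ℂ) (z : Fin g → ℂ) : ℂ :=
  ∑' p : Fin g → ℤ,
    Complex.exp (Real.pi * Complex.I *
      (((fun i => (p i : ℂ)) + halfChar ε) ⬝ᵥ τ.mulVec ((fun i => (p i : ℂ)) + halfChar ε)
        + 2 * (((fun i => (p i : ℂ)) + halfChar ε) ⬝ᵥ (z + halfChar δ))))

/-- The theta function of second order `Θ[σ](τ, z) = θ[σ, 0](2τ, 2z)`. -/
def thetaTwo {g : ℕ} (σ : Fin g → ZMod 2) (τ : Matrix (Fin g) (Fin g) ℂ) (z : Fin g → ℂ) : ℂ :=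
  theta σ 0 ((2 : ℂ) • τ) ((2 : ℂ) • z)

/-- The theta constant of second order `Θ[σ](τ) = Θ[σ](τ, 0)`. -/
def thetaConst {g : ℕ} (σ : Fin g → ZMod 2) (τ : Matrix (Fin g) (Fin g) ℂ) : ℂ :=
  thetaTwo σ τ 0

/-- The partial derivative `∂F/∂z_i`. -/
def dz {g : ℕ} (i : Fin g) (F : (Fin g → ℂ) → ℂ) (z : Fin g → ℂ) : ℂ :=
  lineDeriv ℂ F z (Pi.single i 1)

/-- The matrix `A_{εδ}` with entries
`(∂_{z_i} ∂_{z_j} Θ[δ]) Θ[ε] - (∂_{z_i} ∂_{z_j} Θ[ε]) Θ[δ]` at `z = 0`. -/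
def thetaA {g : ℕ} (ε δ : Fin g → ZMod 2) (τ : Matrix (Fin g) (Fin g) ℂ) :
    Matrix (Fin g) (Fin g) ℂ :=
  Matrix.of fun i j =>
    dz i (dz j (thetaTwo δ τ)) 0 * thetaConst ε τ - dz i (dz j (thetaTwo ε τ)) 0 * thetaConst δ τ

/-! ### Differential operators in `τ`

The coordinates on the space of symmetric matrices are `τ_{ij}` with `i ≤ j`, and
`τ_{ji} = τ_{ij}`. -/

/-- The coordinate vector field `∂/∂τ_{ij}` on the space of symmetric matrices: it moves the entries
`(i, j)` and `(j, i)` simultaneously. -/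
def coordVec {g : ℕ} (i j : Fin g) : Matrix (Fin g) (Fin g) ℂ :=
  Matrix.of fun a b => if (a = i ∧ b = j) ∨ (a = j ∧ b = i) then 1 else 0

/-- The operator `∂_{ij} = ½ (1 + δ_{ij}) ∂/∂τ_{ij}`. -/
def del {g : ℕ} (i j : Fin g) (f : Matrix (Fin g) (Fin g) ℂ → ℂ)
    (τ : Matrix (Fin g) (Fin g) ℂ) : ℂ :=
  (1 + if i = j then 1 else 0) / 2 * lineDeriv ℂ f τ (coordVec i j)

/-- The matrix `∂f = (∂_{ij} f)`. -/
def delMatrix {g : ℕ} (f : Matrix (Fin g) (Fin g) ℂ → ℂ) (τ : Matrix (Fin g) (Fin g) ℂ) :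
    Matrix (Fin g) (Fin g) ℂ :=
  Matrix.of fun i j => del i j f τ

/-- The minor `|∂^I_J| = det (∂_{ij})_{i ∈ I, j ∈ J}`, a differential operator of order `#I`, applied
to `f`.  It is the Leibniz formula in which products of operators are compositions; `I` and `J` are
enumerated increasingly.  Only `#I = #J` is meaningful.  For `I = J = ∅` it is the identity. -/
def delMinor {g : ℕ} (I J : Finset (Fin g)) (f : Matrix (Fin g) (Fin g) ℂ → ℂ)
    (τ : Matrix (Fin g) (Fin g) ℂ) : ℂ :=
  if h : J.card = I.card then
    ∑ σ : Equiv.Perm (Fin I.card), ((Equiv.Perm.sign σ : ℤ) : ℂ) *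
      (List.ofFn fun a : Fin I.card =>
        del (I.orderEmbOfFin rfl (σ a)) (J.orderEmbOfFin h a)).foldr (fun D F => D F) f τ
  else 0

/-- For a subset `s` of a finite ordered set `α`, the sign of the permutation which turns the
sequence `s, sᶜ` (both enumerated increasingly) into the increasing enumeration of `α`. -/
def shuffleSign {α : Type} [Fintype α] [LinearOrder α] (s : Finset α) : ℤˣ :=
  Equiv.Perm.sign
    ((finSumFinEquiv.symm.trans
      (finSumEquivOfFinset (s := s) (m := s.card) (n := sᶜ.card) rfl rfl)).trans
        (monoEquivOfFin α (k := s.card + sᶜ.card) (Finset.card_add_card_compl s).symm).symm.toEquiv)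

/-- Freitag's matrix `B` attached to the pair `f, h`.  The sets `I` and `J` run through the
`k`-element subsets of `{1, …, g} \ {i}` and of `{1, …, g} \ {j}`, and complements are taken in these
sets. -/
def freitagMatrix {g : ℕ} (f h : Matrix (Fin g) (Fin g) ℂ → ℂ) (τ : Matrix (Fin g) (Fin g) ℂ) :
    Matrix (Fin g) (Fin g) ℂ :=
  Matrix.of fun i j =>
    (-1) ^ (i.val + j.val) * ∑ k ∈ Finset.range g, (-1) ^ k / ((g - 1).choose k : ℂ) *
      ∑ I ∈ Finset.powersetCard k (Finset.univ : Finset {x : Fin g // x ≠ i}),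
        ∑ J ∈ Finset.powersetCard k (Finset.univ : Finset {x : Fin g // x ≠ j}),
          ((shuffleSign I : ℤ) : ℂ) * ((shuffleSign J : ℤ) : ℂ) *
            delMinor (I.map (Function.Embedding.subtype _)) (J.map (Function.Embedding.subtype _)) f τ *
            delMinor (Iᶜ.map (Function.Embedding.subtype _)) (Jᶜ.map (Function.Embedding.subtype _)) h τ

/-! ### Differential forms

The tangent space of the Siegel upper half-space at each point is the space of symmetric matrices.
The value of a differential form at a point is an element of the exterior algebra of the dual of
this space, with the wedge product as multiplication. -/

/-- The space of symmetric `g × g` matrices. -/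
def symMatrices (g : ℕ) : Submodule ℂ (Matrix (Fin g) (Fin g) ℂ) where
  carrier := {M | M.IsSymm}
  add_mem' ha hb := ha.add hb
  zero_mem' := Matrix.isSymm_zero
  smul_mem' c _ h := h.smul c

/-- Values of differential forms at a point. -/
abbrev Forms (g : ℕ) : Type := ExteriorAlgebra ℂ (Module.Dual ℂ (symMatrices g))

/-- The coordinate function `τ_{ij}` as a linear form on symmetric matrices. -/
def coord {g : ℕ} (i j : Fin g) : Module.Dual ℂ (symMatrices g) :=
  (Matrix.entryLinearMap ℂ ℂ i j).comp (symMatrices g).subtype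

/-- The differential `dτ_{ij}`. -/
def dtau {g : ℕ} (p : Fin g × Fin g) : Forms g := ExteriorAlgebra.ι ℂ (coord p.1 p.2)

/-- The pairs `(i, j)` with `i ≤ j`, in lexicographic order. -/
def symPairs (g : ℕ) : List (Fin g × Fin g) :=
  (List.finRange g).flatMap fun i => ((List.finRange g).filter fun j => i ≤ j).map fun j => (i, j)

/-- The wedge product of the `dτ_{ij}` over all `i ≤ j`. -/
def topForm (g : ℕ) : Forms g := ((symPairs g).map dtau).prod

/-- The form `dτ̌_{ij} = ± ⋀_{(h,k) ≠ (i,j)} dτ_{hk}` (`h ≤ k`) for `i ≤ j`, and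
`dτ̌_{ji} = dτ̌_{ij}`.  The exponent of the sign is the number of pairs after `(i, j)`; this is the
sign for which `dτ̌_{ij} ∧ dτ_{ij}` is the wedge product of all `dτ_{hk}`, see
`dtauCheck_mul_dtau`. -/
def dtauCheck {g : ℕ} (i j : Fin g) : Forms g :=
  (-1) ^ ((symPairs g).length - 1 - (symPairs g).idxOf (min i j, max i j)) *
    (((symPairs g).erase (min i j, max i j)).map dtau).prod

/-- `tr (B dτ̌) = ∑_{i,j} B_{ij} dτ̌_{ij}`. -/
def traceForm {g : ℕ} (B : Matrix (Fin g) (Fin g) ℂ) : Forms g :=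
  ∑ i, ∑ j, B i j • dtauCheck i j

/-- Freitag's pairing `{f, h}`, a differential form of degree `g(g+1)/2 - 1`. -/
def freitagPairing {g : ℕ} (f h : Matrix (Fin g) (Fin g) ℂ → ℂ)
    (τ : Matrix (Fin g) (Fin g) ℂ) : Forms g :=
  traceForm (freitagMatrix f h τ)

/-- The matrix `4πi (Θ[ε] ∂Θ[δ] - Θ[δ] ∂Θ[ε])`. -/
def thetaADel {g : ℕ} (ε δ : Fin g → ZMod 2) (τ : Matrix (Fin g) (Fin g) ℂ) :
    Matrix (Fin g) (Fin g) ℂ :=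
  (4 * Real.pi * Complex.I : ℂ) •
    (thetaConst ε τ • delMatrix (thetaConst δ) τ - thetaConst δ τ • delMatrix (thetaConst ε) τ)

/-! ### The sign of `dτ̌` -/

theorem prod_map_dtau_mul {g : ℕ} (l : List (Fin g × Fin g)) (p : Fin g × Fin g) :
    (l.map dtau).prod * dtau p = (-1) ^ l.length * (dtau p * (l.map dtau).prod) := by
  induction l with
  | nil => simp
  | cons q l ih =>
    have hc : dtau q * dtau p = -(dtau p * dtau q) := by
      have := ExteriorAlgebra.ι_add_mul_swap (R := ℂ) (coord q.1 q.2) (coord p.1 p.2)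
      exact eq_neg_of_add_eq_zero_left this
    have hm : ((-1 : Forms g) ^ l.length) * dtau q = dtau q * (-1) ^ l.length :=
      ((Commute.neg_one_left (dtau q)).pow_left _).eq
    rw [List.map_cons, List.prod_cons, mul_assoc, ih, ← mul_assoc (dtau q), ← hm, mul_assoc,
      ← mul_assoc (dtau q), hc, List.length_cons, pow_succ]
    simp [mul_assoc]

theorem sign_erase_mul_dtau {g : ℕ} (l : List (Fin g × Fin g)) (p : Fin g × Fin g) (hp : p ∈ l) :
    (-1) ^ (l.length - 1 - l.idxOf p) * ((l.erase p).map dtau).prod * dtau p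
      = (l.map dtau).prod := by
  induction l with
  | nil => simp at hp
  | cons q l ih =>
    by_cases hq : q = p
    · subst hq
      rw [List.erase_cons_head, mul_assoc, prod_map_dtau_mul, ← mul_assoc, ← pow_add]
      simp [← two_mul]
    · have hp' : p ∈ l := by
        rcases List.mem_cons.1 hp with h | h
        · exact absurd h.symm hq
        · exact h
      rw [List.erase_cons_tail (by simpa using hq), List.idxOf_cons_ne _ hq, List.map_cons,
        List.prod_cons, List.map_cons, List.prod_cons, ← ih hp']
      have e : (q :: l).length - 1 - (l.idxOf p).succ = l.length - 1 - l.idxOf p := by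
        simp only [List.length_cons]; omega
      have hm : ((-1 : Forms g) ^ (l.length - 1 - l.idxOf p)) * dtau q
          = dtau q * (-1) ^ (l.length - 1 - l.idxOf p) :=
        ((Commute.neg_one_left (dtau q)).pow_left _).eq
      rw [e, ← mul_assoc, hm]
      simp only [mul_assoc]

/-- The defining property of `dτ̌_{ij}`. -/
theorem dtauCheck_mul_dtau {g : ℕ} (i j : Fin g) (hij : i ≤ j) :
    dtauCheck i j * dtau (i, j) = topForm g := by
  unfold dtauCheck topForm
  rw [min_eq_left hij, max_eq_right hij]
  exact sign_erase_mul_dtau _ _ (by simp [symPairs, hij])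

end SiegelTheta

end

/-!
The `n`-th power of a theta constant is a series of exponentials `exp (2πi tr (M τ))` whose matrices
`M = ∑ a, q_a q_aᵗ` are sums of `n` matrices of rank one, and a minor of `∂` acts on it termwise
through the corresponding minor of `2πi M`.  Expanding this minor column by column, the assignments
of a summand `q_a q_aᵗ` to each column that use a summand twice contribute nothing; hence
`|∂^I_J| Θ^n = n! / (n - k)! Θ^(n - k) det (∂_{ij} Θ)_{i ∈ I, j ∈ J}` with `k = #I`, without higher
derivatives of `Θ`.  For `n = g - 1` the product of the factors from `I` and from its complement is
`n! * (n choose k)`, which cancels the binomial coefficient in Freitag's matrix, and what remains is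
the Laplace expansion of the cofactors of `Θ[ε] ∂Θ[δ] - Θ[δ] ∂Θ[ε]`.  The matrix is determined by
the form because the `dτ̌_{ij}` with `i ≤ j` are linearly independent, and `thetaA` is `2` times
`thetaADel` by the heat equation `∂_{z_i} ∂_{z_j} Θ = 8πi ∂_{ij} Θ`.
-/

noncomputable section

namespace SiegelTheta

/-! ### Products of series -/

section ProductSeries

variable {X R : Type*} [NormedCommRing R]

theorem summable_norm_prod_pi {n : ℕ} {f : Fin n → X → R}
    (hf : ∀ a, Summable fun x => ‖f a x‖) :
    Summable fun P : Fin n → X => ‖∏ a, f a (P a)‖ := by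
  induction n with
  | zero => exact (hasSum_fintype _).summable
  | succ n ih =>
    rw [← (Fin.consEquiv fun _ : Fin (n + 1) => X).summable_iff]
    refine ((hf 0).mul_norm (ih fun a => hf a.succ)).congr fun x => ?_
    simp [Fin.consEquiv, Fin.prod_univ_succ]

theorem tsum_prod_pi [CompleteSpace R] {n : ℕ} {f : Fin n → X → R}
    (hf : ∀ a, Summable fun x => ‖f a x‖) :
    ∑' P : Fin n → X, ∏ a, f a (P a) = ∏ a, ∑' x, f a x := by
  induction n with
  | zero => simp
  | succ n ih =>
    rw [← (Fin.consEquiv fun _ : Fin (n + 1) => X).tsum_eq, Fin.prod_univ_succ,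
      ← ih fun a => hf a.succ,
      tsum_mul_tsum_of_summable_norm (hf 0) (summable_norm_prod_pi fun a => hf a.succ)]
    refine tsum_congr fun x => ?_
    simp [Fin.consEquiv, Fin.prod_univ_succ]

end ProductSeries

/-! ### Rapidly decaying families -/

/-- The family `w` is absolutely summable against some exponential `exp (r |N x|)`, `r > 0`, of the
weight `N`.  This is what makes series `∑ exp (t b x) w x` with `b = O(N)` differentiable in `t`. -/
def RapidDecay {X : Type*} (N : X → ℝ) (w : X → ℂ) : Prop :=
  ∃ r > 0, Summable fun x => ‖w x‖ * Real.exp (r * |N x|)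

namespace RapidDecay

variable {X : Type*} {N : X → ℝ} {w b : X → ℂ}

theorem summable_norm (h : RapidDecay N w) : Summable fun x => ‖w x‖ := by
  obtain ⟨r, hr, h⟩ := h
  refine h.of_nonneg_of_le (fun x => norm_nonneg _) fun x => ?_
  exact le_mul_of_one_le_right (norm_nonneg _) (Real.one_le_exp (by positivity))

theorem mul_of_isBigO (h : RapidDecay N w) (hb : b =O[⊤] N) :
    RapidDecay N fun x => b x * w x := by
  obtain ⟨r, hr, h⟩ := h
  obtain ⟨C, hC, hb⟩ := hb.exists_pos
  rw [Asymptotics.isBigOWith_top] at hb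
  refine ⟨r / 2, half_pos hr, (h.mul_left (C * (2 / r))).of_nonneg_of_le
    (fun x => by positivity) fun x => ?_⟩
  have hN : |N x| ≤ 2 / r * Real.exp (r / 2 * |N x|) :=
    calc |N x| = 2 / r * (r / 2 * |N x|) := by field_simp
      _ ≤ 2 / r * Real.exp (r / 2 * |N x|) := by
        gcongr
        linarith [Real.add_one_le_exp (r / 2 * |N x|)]
  have hexp : Real.exp (r * |N x|) = Real.exp (r / 2 * |N x|) * Real.exp (r / 2 * |N x|) := by
    rw [← Real.exp_add]; ring_nf
  calc ‖b x * w x‖ * Real.exp (r / 2 * |N x|)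
      = ‖b x‖ * (‖w x‖ * Real.exp (r / 2 * |N x|)) := by rw [norm_mul]; ring
    _ ≤ C * (2 / r * Real.exp (r / 2 * |N x|)) * (‖w x‖ * Real.exp (r / 2 * |N x|)) := by
      gcongr
      exact (hb x).trans (by gcongr; exact hN)
    _ = C * (2 / r) * (‖w x‖ * Real.exp (r * |N x|)) := by rw [hexp]; ring

theorem prod {n : ℕ} (h : RapidDecay N w) :
    RapidDecay (fun P : Fin n → X => ∑ a, |N (P a)|) fun P => ∏ a, w (P a) := by
  obtain ⟨r, hr, h⟩ := h
  refine ⟨r, hr, (summable_norm_prod_pi fun _ => h.norm).congr fun P => ?_⟩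
  rw [abs_of_nonneg (Finset.sum_nonneg fun a _ => abs_nonneg _), Finset.mul_sum, Real.exp_sum,
    norm_prod, norm_prod, ← Finset.prod_mul_distrib]
  simp only [norm_mul, norm_norm, Real.norm_of_nonneg (Real.exp_nonneg _)]

theorem hasDerivAt_tsum_exp_mul (h : RapidDecay N w) (hb : b =O[⊤] N) :
    HasDerivAt (fun t : ℂ => ∑' x, Complex.exp (t * b x) * w x) (∑' x, b x * w x) 0 := by
  obtain ⟨r, hr, h⟩ := h
  obtain ⟨C, hC, hb⟩ := hb.exists_pos
  rw [Asymptotics.isBigOWith_top] at hb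
  set U := Metric.ball (0 : ℂ) (r / C)
  have hderiv : ∀ x (t : ℂ), HasDerivAt (fun t : ℂ => Complex.exp (t * b x) * w x)
      (Complex.exp (t * b x) * b x * w x) t := fun x t => by
    simpa using ((hasDerivAt_id t).mul_const (b x)).cexp.mul_const (w x)
  have hdiff : ∀ x, DifferentiableOn ℂ (fun t : ℂ => Complex.exp (t * b x) * w x) U :=
    fun x t _ => (hderiv x t).differentiableAt.differentiableWithinAt
  have hle : ∀ x, ∀ t ∈ U, ‖Complex.exp (t * b x) * w x‖ ≤ ‖w x‖ * Real.exp (r * |N x|) := by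
    intro x t ht
    rw [norm_mul, mul_comm, Complex.norm_exp]
    gcongr
    calc (t * b x).re ≤ ‖t‖ * ‖b x‖ := (Complex.re_le_norm _).trans_eq (norm_mul _ _)
      _ ≤ r / C * (C * |N x|) := by
        gcongr
        exacts [(mem_ball_zero_iff.1 ht).le, hb x]
      _ = r * |N x| := by field_simp
  have h0 : (0 : ℂ) ∈ U := Metric.mem_ball_self (by positivity)
  have hsum := Complex.hasSum_deriv_of_summable_norm h hdiff Metric.isOpen_ball hle h0
  have htsum := (Complex.differentiableOn_tsum_of_summable_norm h hdiff Metric.isOpen_ball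
    hle).hasDerivAt (Metric.isOpen_ball.mem_nhds h0)
  rw [← hsum.tsum_eq] at htsum
  simpa [(hderiv _ _).deriv] using htsum

theorem hasLineDerivAt_tsum {E : Type*} [AddCommGroup E] [Module ℂ E] {e : X → E → ℂ} {u v : E}
    (h : RapidDecay N fun x => e x v) (hb : b =O[⊤] N)
    (he : ∀ x (t : ℂ), e x (v + t • u) = Complex.exp (t * b x) * e x v) :
    HasLineDerivAt ℂ (fun v => ∑' x, e x v) (∑' x, b x * e x v) v u := by
  simpa only [HasLineDerivAt, he] using h.hasDerivAt_tsum_exp_mul hb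

end RapidDecay

/-! ### The Siegel upper half-space is open in the symmetric matrices -/

section PosDef

variable {ι : Type*} [Fintype ι]

theorem sq_apply_le_dotProduct_self (x : ι → ℝ) (i : ι) : x i ^ 2 ≤ x ⬝ᵥ x := by
  rw [pow_two]
  exact Finset.single_le_sum (f := fun i => x i * x i) (fun _ _ => mul_self_nonneg _)
    (Finset.mem_univ i)

theorem abs_mul_apply_le_dotProduct_self (x : ι → ℝ) (i j : ι) : |x i * x j| ≤ x ⬝ᵥ x := by
  have hi := sq_apply_le_dotProduct_self x i
  have hj := sq_apply_le_dotProduct_self x j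
  rw [abs_le]
  constructor <;> nlinarith [sq_nonneg (x i + x j), sq_nonneg (x i - x j)]

theorem abs_dotProduct_mulVec_le (A : Matrix ι ι ℝ) (x : ι → ℝ) :
    |x ⬝ᵥ A.mulVec x| ≤ (∑ i, ∑ j, |A i j|) * (x ⬝ᵥ x) := by
  have hexpand : x ⬝ᵥ A.mulVec x = ∑ i, ∑ j, A i j * (x i * x j) := by
    simp only [dotProduct, Matrix.mulVec, Finset.mul_sum, mul_left_comm]
  simp only [hexpand, Finset.sum_mul]
  refine (Finset.abs_sum_le_sum_abs _ _).trans (Finset.sum_le_sum fun i _ =>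
    (Finset.abs_sum_le_sum_abs _ _).trans (Finset.sum_le_sum fun j _ => ?_))
  rw [abs_mul]
  gcongr
  exact abs_mul_apply_le_dotProduct_self x i j

open scoped MatrixOrder in
theorem exists_pos_mul_dotProduct_self_le {A : Matrix ι ι ℝ} (hA : A.PosDef) :
    ∃ c > 0, ∀ x : ι → ℝ, c * (x ⬝ᵥ x) ≤ x ⬝ᵥ A.mulVec x := by
  classical
  cases isEmpty_or_nonempty ι
  · exact ⟨1, one_pos, fun x => by simp⟩
  obtain ⟨c, hc, hle⟩ := (CFC.exists_pos_algebraMap_le_iff hA.1).2 fun _ =>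
    hA.isStrictlyPositive.spectrum_pos
  refine ⟨c, hc, fun x => ?_⟩
  have hx := (Matrix.le_iff.1 hle).dotProduct_mulVec_nonneg x
  rw [Matrix.sub_mulVec, dotProduct_sub, sub_nonneg, Algebra.algebraMap_eq_smul_one] at hx
  simpa [Matrix.smul_mulVec] using hx

end PosDef

theorem eventually_posDef {ι : Type*} [Finite ι] {A : Matrix ι ι ℝ} (hA : A.PosDef) :
    ∀ᶠ B in nhds A, B.IsHermitian → B.PosDef := by
  have := Fintype.ofFinite ι
  obtain ⟨c, hc, hle⟩ := exists_pos_mul_dotProduct_self_le hA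
  have hcont : Continuous fun B : Matrix ι ι ℝ => ∑ i, ∑ j, |(B - A) i j| := by fun_prop
  filter_upwards [hcont.continuousAt.eventually_lt_const (by simpa using hc)] with B hB hherm
  refine Matrix.posDef_iff_dotProduct_mulVec.2 ⟨hherm, fun x hx => ?_⟩
  have hpos : 0 < x ⬝ᵥ x := by simpa using Matrix.dotProduct_star_self_pos_iff.2 hx
  have hdiff := neg_abs_le (x ⬝ᵥ (B - A).mulVec x)
  have hbound := abs_dotProduct_mulVec_le (B - A) x
  rw [Matrix.sub_mulVec, dotProduct_sub] at hdiff hbound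
  rw [star_trivial]
  nlinarith [hle x]

variable {g : ℕ}

theorem eventually_add_smul_mem_siegelUpperHalfSpace {τ V : Matrix (Fin g) (Fin g) ℂ}
    (hτ : τ ∈ siegelUpperHalfSpace g) (hV : V.IsSymm) :
    ∀ᶠ t : ℂ in nhds 0, τ + t • V ∈ siegelUpperHalfSpace g := by
  have hcont : Continuous fun t : ℂ => (τ + t • V).map Complex.im := by
    unfold Matrix.map; fun_prop
  have hev := hcont.continuousAt (x := 0) |>.eventually (eventually_posDef (by simpa using hτ.2))
  filter_upwards [hev] with t ht
  have hsymm : (τ + t • V).IsSymm := hτ.1.add (hV.smul t)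
  exact ⟨hsymm, ht (hsymm.map Complex.im)⟩

/-! ### Determinants of sums of rank-one matrices -/

section RankOne

/-- Expanding each column of `∑ a, x a (y a)ᵀ`, an assignment of summands to columns which uses a
summand twice contributes a determinant with two proportional columns. -/
theorem det_sum_vecMulVec {m n R : Type*} [Fintype m] [DecidableEq m] [Fintype n] [CommRing R]
    (x y : n → m → R) :
    (∑ a, Matrix.vecMulVec (x a) (y a)).det
      = ∑ φ : m ↪ n, (Matrix.of fun i j => x (φ j) i * y (φ j) j).det := by
  classical
  have hexpand : (∑ a, Matrix.vecMulVec (x a) (y a)).det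
      = ∑ φ : m → n, (Matrix.of fun i j => x (φ j) i * y (φ j) j).det := by
    simp only [Matrix.det_apply', Matrix.sum_apply, Matrix.vecMulVec_apply, Matrix.of_apply,
      Finset.prod_univ_sum, Fintype.piFinset_univ, Finset.mul_sum]
    exact Finset.sum_comm
  rw [hexpand]
  refine (Fintype.sum_of_injective (fun φ : m ↪ n => ⇑φ) DFunLike.coe_injective _ _
    (fun φ hφ => ?_) fun _ => rfl).symm
  obtain ⟨c, d, hcd, hne⟩ : ∃ c d, φ c = φ d ∧ c ≠ d := by
    by_contra! hinj
    exact hφ ⟨⟨φ, hinj⟩, rfl⟩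
  have hcol : (Matrix.of fun i j => x (φ j) i).det = 0 :=
    Matrix.det_zero_of_column_eq hne fun i => by simp only [Matrix.of_apply, hcd]
  have hdet := Matrix.det_mul_row (fun j => y (φ j) j) (Matrix.of fun i j => x (φ j) i)
  rw [hcol, mul_zero] at hdet
  simpa only [mul_comm, Matrix.of_apply] using hdet

variable {m X R : Type*} [Fintype m] [NormedCommRing R] [CompleteSpace R] {k : ℕ} {t : X → R}

theorem hasSum_prod_embedding_mul_prod {u : m → X → R} (φ : m ↪ Fin k)
    (hu : ∀ c, Summable fun p => ‖u c p * t p‖) (ht : Summable fun p => ‖t p‖) :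
    HasSum (fun P : Fin k → X => (∏ c, u c (P (φ c))) * ∏ a, t (P a))
      ((∑' p, t p) ^ (k - Fintype.card m) * ∏ c, ∑' p, u c p * t p) := by
  set v : Fin k → X → R := Function.extend φ u 1
  have hv : ∀ c, v (φ c) = u c := φ.injective.extend_apply _ _
  have hv' : ∀ a, (¬ ∃ c, φ c = a) → v a = 1 := Function.extend_apply' _ _
  have hsummable : ∀ a, Summable fun p => ‖v a p * t p‖ := fun a => by
    by_cases ha : ∃ c, φ c = a
    · obtain ⟨c, rfl⟩ := ha
      simpa only [hv] using hu c
    · simpa only [hv' a ha, Pi.one_apply, one_mul] using ht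
  have hsum := (summable_norm_prod_pi hsummable).of_norm.hasSum
  rw [tsum_prod_pi hsummable, ← Finset.prod_mul_prod_compl (Finset.univ.map φ), mul_comm,
    Finset.prod_map] at hsum
  have hcompl : ∀ a ∈ (Finset.univ.map φ)ᶜ, ∑' p, v a p * t p = ∑' p, t p := fun a ha => by
    rw [hv' a (by simpa using ha)]
    simp only [Pi.one_apply, one_mul]
  rw [Finset.prod_congr rfl hcompl, Finset.prod_const, Finset.card_compl, Finset.card_map,
    Fintype.card_fin, Finset.card_univ] at hsum
  have hprod : ∀ P : Fin k → X, ∏ c, u c (P (φ c)) = ∏ a, v a (P a) := fun P =>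
    Fintype.prod_of_injective φ φ.injective _ _
      (fun a ha => by rw [hv' a ha, Pi.one_apply]) fun c => by rw [hv]
  simpa only [hprod, hv, Finset.prod_mul_distrib] using hsum

theorem hasSum_det_sum_vecMulVec_mul_prod [DecidableEq m] {x y : X → m → R}
    (hxy : ∀ i j, Summable fun p => ‖x p i * y p j * t p‖) (ht : Summable fun p => ‖t p‖) :
    HasSum (fun P : Fin k → X =>
        (∑ a, Matrix.vecMulVec (x (P a)) (y (P a))).det * ∏ a, t (P a))
      (k.descFactorial (Fintype.card m) * (∑' p, t p) ^ (k - Fintype.card m) *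
        (Matrix.of fun i j => ∑' p, x p i * y p j * t p).det) := by
  have hembedding : ∀ φ : m ↪ Fin k, HasSum (fun P : Fin k → X =>
      (Matrix.of fun i j => x (P (φ j)) i * y (P (φ j)) j).det * ∏ a, t (P a))
      ((∑' p, t p) ^ (k - Fintype.card m) *
        (Matrix.of fun i j => ∑' p, x p i * y p j * t p).det) := fun φ => by
    simp only [Matrix.det_apply', Finset.mul_sum, Finset.sum_mul, Matrix.of_apply]
    refine hasSum_sum fun σ _ => ?_
    have := (hasSum_prod_embedding_mul_prod (u := fun c p => x p (σ c) * y p c) φ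
      (fun c => hxy _ _) ht).mul_left ((Equiv.Perm.sign σ : ℤ) : R)
    simpa only [mul_assoc, mul_left_comm] using this
  have hsum := hasSum_sum fun φ (_ : φ ∈ Finset.univ) => hembedding φ
  simpa only [det_sum_vecMulVec, Finset.sum_mul, Finset.sum_const, Finset.card_univ,
    Fintype.card_embedding_eq, Fintype.card_fin, nsmul_eq_mul, mul_assoc] using hsum

end RankOne

/-! ### Laplace expansion of the determinant of a sum -/

section Minor

variable {α β R : Type*} [LinearOrder α] [LinearOrder β] [CommRing R]

/-- The minor of `A` with rows `I` and columns `J`, enumerated increasingly; as for `delMinor`, the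
value is `0` if `I` and `J` do not have the same size. -/
def minorDet (A : Matrix α β R) (I : Finset α) (J : Finset β) : R :=
  if h : J.card = I.card then (A.submatrix (I.orderEmbOfFin rfl) (J.orderEmbOfFin h)).det else 0

theorem minorDet_eq {k : ℕ} (A : Matrix α β R) {I : Finset α} {J : Finset β} (hI : I.card = k)
    (hJ : J.card = k) :
    minorDet A I J = (A.submatrix (I.orderEmbOfFin hI) (J.orderEmbOfFin hJ)).det := by
  subst hI
  rw [minorDet, dif_pos hJ]

theorem minorDet_smul (c : R) (A : Matrix α β R) (I : Finset α) (J : Finset β) :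
    minorDet (c • A) I J = c ^ I.card * minorDet A I J := by
  unfold minorDet
  split_ifs with h
  · rw [Matrix.submatrix_smul, Pi.smul_apply, Pi.smul_apply, Matrix.det_smul, Fintype.card_fin]
  · rw [mul_zero]

theorem orderEmbOfFin_map_subtype {p : α → Prop} {k : ℕ} (I : Finset {x // p x})
    (hI : I.card = k) (hI' : (I.map (Function.Embedding.subtype _)).card = k) (x : Fin k) :
    (I.map (Function.Embedding.subtype _)).orderEmbOfFin hI' x = (I.orderEmbOfFin hI x : α) := by
  refine (congrFun (Finset.orderEmbOfFin_unique hI' (f := fun x => (I.orderEmbOfFin hI x : α))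
    (fun x => ?_) fun a b hab => ?_) x).symm
  · exact Finset.mem_map_of_mem (Function.Embedding.subtype _) (I.orderEmbOfFin_mem hI x)
  · exact (I.orderEmbOfFin hI).strictMono hab

theorem minorDet_map_subtype {p : α → Prop} {q : β → Prop} (A : Matrix α β R)
    (I : Finset {x // p x}) (J : Finset {x // q x}) :
    minorDet A (I.map (Function.Embedding.subtype _)) (J.map (Function.Embedding.subtype _))
      = minorDet (A.submatrix Subtype.val Subtype.val) I J := by
  by_cases h : J.card = I.card
  · rw [minorDet_eq A (Finset.card_map _) ((Finset.card_map _).trans h), minorDet_eq _ rfl h]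
    congr 1
    ext a b
    simp only [Matrix.submatrix_apply, orderEmbOfFin_map_subtype I rfl,
      orderEmbOfFin_map_subtype J h]
  · rw [minorDet, minorDet, dif_neg h, dif_neg (by simpa using h)]

end Minor

theorem prod_orderEmbOfFin {β M : Type*} [LinearOrder β] [CommMonoid M] {J : Finset β} {k : ℕ}
    (hJ : J.card = k) (f : β → M) : ∏ x, f (J.orderEmbOfFin hJ x) = ∏ y ∈ J, f y := by
  conv_rhs => rw [← Finset.map_orderEmbOfFin_univ J hJ, Finset.prod_map]
  rfl

section BlockEquiv

variable {α β : Type*} [Fintype α] [LinearOrder α] [Fintype β] [LinearOrder β] {k m : ℕ}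
  {I : Finset α} {J : Finset β} (hI : I.card = k) (hIc : Iᶜ.card = m) (hJ : J.card = k)
  (hJc : Jᶜ.card = m)

/-- The bijection which maps `J` onto `I` by the permutation `ab.1` and `Jᶜ` onto `Iᶜ` by the
permutation `ab.2`, when all four sets are enumerated increasingly. -/
def blockEquiv (ab : Equiv.Perm (Fin k) × Equiv.Perm (Fin m)) : β ≃ α :=
  (finSumEquivOfFinset hJ hJc).symm.trans
    ((Equiv.Perm.sumCongr ab.1 ab.2).trans (finSumEquivOfFinset hI hIc))

theorem blockEquiv_orderEmbOfFin (ab : Equiv.Perm (Fin k) × Equiv.Perm (Fin m)) (x : Fin k) :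
    blockEquiv hI hIc hJ hJc ab (J.orderEmbOfFin hJ x) = I.orderEmbOfFin hI (ab.1 x) := by
  have hx : (finSumEquivOfFinset hJ hJc).symm (J.orderEmbOfFin hJ x) = Sum.inl x := by
    rw [Equiv.symm_apply_eq, finSumEquivOfFinset_inl]
  simp [blockEquiv, hx]

theorem blockEquiv_orderEmbOfFin_compl (ab : Equiv.Perm (Fin k) × Equiv.Perm (Fin m))
    (x : Fin m) :
    blockEquiv hI hIc hJ hJc ab (Jᶜ.orderEmbOfFin hJc x) = Iᶜ.orderEmbOfFin hIc (ab.2 x) := by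
  have hx : (finSumEquivOfFinset hJ hJc).symm (Jᶜ.orderEmbOfFin hJc x) = Sum.inr x := by
    rw [Equiv.symm_apply_eq, finSumEquivOfFinset_inr]
  simp [blockEquiv, hx]

theorem blockEquiv_injective : Function.Injective (blockEquiv hI hIc hJ hJc) := fun ab ab' h => by
  refine Equiv.Perm.sumCongrHom_injective (Equiv.ext fun x => ?_)
  simpa [blockEquiv] using
    congrArg (fun e => (finSumEquivOfFinset hI hIc).symm (e (finSumEquivOfFinset hJ hJc x))) h

theorem map_blockEquiv (ab : Equiv.Perm (Fin k) × Equiv.Perm (Fin m)) :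
    J.map (blockEquiv hI hIc hJ hJc ab).toEmbedding = I := by
  refine Finset.eq_of_subset_of_card_le (fun x hx => ?_) (by rw [Finset.card_map, hI, hJ])
  obtain ⟨y, hy, rfl⟩ := Finset.mem_map.1 hx
  obtain ⟨u, rfl⟩ : y ∈ Set.range (J.orderEmbOfFin hJ) := by simpa using hy
  rw [Equiv.coe_toEmbedding, blockEquiv_orderEmbOfFin]
  exact I.orderEmbOfFin_mem hI _

theorem exists_blockEquiv_eq {τ : β ≃ α} (hτ : J.map τ.toEmbedding = I) :
    ∃ ab, blockEquiv hI hIc hJ hJc ab = τ := by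
  set EI := finSumEquivOfFinset hI hIc
  set EJ := finSumEquivOfFinset hJ hJc
  have hmap : Set.MapsTo (EJ.trans (τ.trans EI.symm)) (Set.range Sum.inl) (Set.range Sum.inl) := by
    rintro _ ⟨x, rfl⟩
    have hx : τ (EJ (Sum.inl x)) ∈ I :=
      hτ ▸ Finset.mem_map_of_mem τ.toEmbedding (J.orderEmbOfFin_mem hJ x)
    obtain ⟨u, hu⟩ : τ (EJ (Sum.inl x)) ∈ Set.range (I.orderEmbOfFin hI) := by simpa using hx
    exact ⟨u, by simp [EI, ← hu, Equiv.eq_symm_apply]⟩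
  obtain ⟨ab, hab⟩ := Equiv.Perm.mem_sumCongrHom_range_of_perm_mapsTo_inl hmap
  have hab' : Equiv.Perm.sumCongr ab.1 ab.2 = EJ.trans (τ.trans EI.symm) := hab
  exact ⟨ab, by ext y; simp [blockEquiv, hab', EI, EJ]⟩

variable {R : Type*} [CommMonoid R]

theorem prod_blockEquiv (A : Matrix α β R) (ab : Equiv.Perm (Fin k) × Equiv.Perm (Fin m)) :
    ∏ y ∈ J, A (blockEquiv hI hIc hJ hJc ab y) y
      = ∏ x, A (I.orderEmbOfFin hI (ab.1 x)) (J.orderEmbOfFin hJ x) := by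
  simp only [← prod_orderEmbOfFin hJ, blockEquiv_orderEmbOfFin]

theorem prod_compl_blockEquiv (B : Matrix α β R)
    (ab : Equiv.Perm (Fin k) × Equiv.Perm (Fin m)) :
    ∏ y ∈ Jᶜ, B (blockEquiv hI hIc hJ hJc ab y) y
      = ∏ x, B (Iᶜ.orderEmbOfFin hIc (ab.2 x)) (Jᶜ.orderEmbOfFin hJc x) := by
  simp only [← prod_orderEmbOfFin hJc, blockEquiv_orderEmbOfFin_compl]

end BlockEquiv

section Laplace

variable {α β : Type} [Fintype α] [LinearOrder α] [Fintype β] [LinearOrder β]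
  {R : Type*} [CommRing R] {n k m : ℕ}

theorem shuffleSign_eq_sign {I : Finset α} (hI : I.card = k) (hIc : Iᶜ.card = m)
    (e : Fin (k + m) ≃o α) :
    shuffleSign I = Equiv.Perm.sign
      ((finSumFinEquiv.symm.trans (finSumEquivOfFinset hI hIc)).trans e.symm.toEquiv) := by
  subst hI hIc
  rw [shuffleSign, Subsingleton.elim (monoEquivOfFin α _).symm e.symm]

theorem sign_blockEquiv {I : Finset α} {J : Finset β} (hI : I.card = k) (hIc : Iᶜ.card = m)
    (hJ : J.card = k) (hJc : Jᶜ.card = m) (eα : Fin (k + m) ≃o α) (eβ : Fin (k + m) ≃o β)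
    (ab : Equiv.Perm (Fin k) × Equiv.Perm (Fin m)) :
    Equiv.Perm.sign ((eβ.toEquiv.trans (blockEquiv hI hIc hJ hJc ab)).trans eα.symm.toEquiv)
      = shuffleSign I * shuffleSign J * (Equiv.Perm.sign ab.1 * Equiv.Perm.sign ab.2) := by
  rw [shuffleSign_eq_sign hI hIc eα, shuffleSign_eq_sign hJ hJc eβ,
    ← Equiv.Perm.sign_sumCongr ab.1 ab.2,
    ← Equiv.Perm.sign_permCongr finSumFinEquiv (Equiv.Perm.sumCongr ab.1 ab.2),
    ← Equiv.Perm.sign_inv (Equiv.trans (Equiv.trans finSumFinEquiv.symm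
      (finSumEquivOfFinset hJ hJc)) _), mul_assoc,
    mul_comm (Equiv.Perm.sign (_)⁻¹), ← Equiv.Perm.sign_mul, ← Equiv.Perm.sign_mul]
  congr 1
  ext x
  simp [Equiv.Perm.inv_def, blockEquiv, Equiv.permCongr_apply]

theorem det_submatrix_orderIso (A : Matrix α β R) (eα : Fin n ≃o α) (eβ : Fin n ≃o β) :
    (A.submatrix eα eβ).det = ∑ τ : β ≃ α,
      ((Equiv.Perm.sign ((eβ.toEquiv.trans τ).trans eα.symm.toEquiv) : ℤ) : R) *
        ∏ y, A (τ y) y := by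
  rw [Matrix.det_apply']
  refine Fintype.sum_equiv (Equiv.equivCongr eβ.toEquiv eα.toEquiv) _ _ fun σ => ?_
  rw [← eβ.toEquiv.prod_comp]
  congr 1
  · congr 3
    ext x
    simp
  · simp

theorem card_compl_of_orderIso (e : Fin n ≃o α) {I : Finset α} (hI : I.card = k) :
    Iᶜ.card = n - k := by
  rw [Finset.card_compl, hI, ← Fintype.card_congr e.toEquiv, Fintype.card_fin]

theorem sum_equiv_map_eq_minorDet_mul_minorDet (A B : Matrix α β R) (eα : Fin n ≃o α)
    (eβ : Fin n ≃o β) {I : Finset α} {J : Finset β} (hI : I.card = k) (hJ : J.card = k) :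
    ∑ τ : β ≃ α with J.map τ.toEmbedding = I,
      ((Equiv.Perm.sign ((eβ.toEquiv.trans τ).trans eα.symm.toEquiv) : ℤ) : R) *
        ((∏ y ∈ J, A (τ y) y) * ∏ y ∈ Jᶜ, B (τ y) y)
    = ((shuffleSign I : ℤ) : R) * ((shuffleSign J : ℤ) : R) * minorDet A I J *
      minorDet B Iᶜ Jᶜ := by
  obtain ⟨m, rfl⟩ : ∃ m, n = k + m := Nat.exists_eq_add_of_le <| by
    rw [← hI, ← Fintype.card_fin n, Fintype.card_congr eα.toEquiv]
    exact I.card_le_univ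
  have hIc : Iᶜ.card = m := by rw [card_compl_of_orderIso eα hI, Nat.add_sub_cancel_left]
  have hJc : Jᶜ.card = m := by rw [card_compl_of_orderIso eβ hJ, Nat.add_sub_cancel_left]
  have hblocks : (Finset.univ.filter fun τ : β ≃ α => J.map τ.toEmbedding = I)
      = Finset.univ.map ⟨blockEquiv hI hIc hJ hJc, blockEquiv_injective hI hIc hJ hJc⟩ := by
    ext τ
    simp only [Finset.mem_filter, Finset.mem_univ, true_and, Finset.mem_map,
      Function.Embedding.coeFn_mk]
    exact ⟨exists_blockEquiv_eq hI hIc hJ hJc, fun ⟨ab, hab⟩ => hab ▸ map_blockEquiv ..⟩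
  rw [hblocks, Finset.sum_map, Fintype.sum_prod_type, minorDet_eq A hI hJ, minorDet_eq B hIc hJc,
    Matrix.det_apply', Matrix.det_apply', mul_assoc _ (Finset.sum _ _), Finset.sum_mul_sum]
  simp only [Finset.mul_sum, Function.Embedding.coeFn_mk, sign_blockEquiv, prod_blockEquiv,
    prod_compl_blockEquiv, Matrix.submatrix_apply]
  refine Finset.sum_congr rfl fun a _ => Finset.sum_congr rfl fun b _ => ?_
  push_cast
  ring

theorem det_add_submatrix_orderIso (A B : Matrix α β R) (eα : Fin n ≃o α) (eβ : Fin n ≃o β) :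
    ((A + B).submatrix eα eβ).det = ∑ k ∈ Finset.range (n + 1),
      ∑ I ∈ Finset.powersetCard k (Finset.univ : Finset α),
        ∑ J ∈ Finset.powersetCard k (Finset.univ : Finset β),
          ((shuffleSign I : ℤ) : R) * ((shuffleSign J : ℤ) : R) * minorDet A I J *
            minorDet B Iᶜ Jᶜ := by
  have hcard : (Finset.univ : Finset β).card = n := by
    rw [Finset.card_univ, ← Fintype.card_congr eβ.toEquiv, Fintype.card_fin]
  simp only [det_submatrix_orderIso, Matrix.add_apply, Finset.prod_add, Finset.mul_sum]
  rw [Finset.sum_comm, Finset.sum_powerset, hcard]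
  refine Finset.sum_congr rfl fun k _ => ?_
  rw [Finset.sum_comm (s := Finset.powersetCard k (Finset.univ : Finset α))]
  refine Finset.sum_congr rfl fun J hJ => ?_
  have hJk := (Finset.mem_powersetCard.1 hJ).2
  simp only [← Finset.compl_eq_univ_sdiff]
  rw [← Finset.sum_fiberwise_of_maps_to (t := Finset.powersetCard k (Finset.univ : Finset α))
    (g := fun τ : β ≃ α => J.map τ.toEmbedding) fun τ _ => by simp [hJk]]
  exact Finset.sum_congr rfl fun I hI =>
    sum_equiv_map_eq_minorDet_mul_minorDet A B eα eβ (Finset.mem_powersetCard.1 hI).2 hJk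

end Laplace

/-- The increasing enumeration of the complement of a point. -/
def succAboveOrderIso {n : ℕ} (i : Fin (n + 1)) : Fin n ≃o {x : Fin (n + 1) // x ≠ i} where
  toEquiv := finSuccAboveEquiv i
  map_rel_iff' := (Fin.succAboveOrderEmb i).le_iff_le

theorem adjugate_add_apply {n : ℕ} {R : Type*} [CommRing R]
    (A B : Matrix (Fin (n + 1)) (Fin (n + 1)) R) (i j : Fin (n + 1)) :
    (A + B).adjugate j i = (-1) ^ (i.val + j.val) * ∑ k ∈ Finset.range (n + 1),
      ∑ I ∈ Finset.powersetCard k (Finset.univ : Finset {x : Fin (n + 1) // x ≠ i}),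
        ∑ J ∈ Finset.powersetCard k (Finset.univ : Finset {x : Fin (n + 1) // x ≠ j}),
          ((shuffleSign I : ℤ) : R) * ((shuffleSign J : ℤ) : R) *
            minorDet A (I.map (Function.Embedding.subtype _))
              (J.map (Function.Embedding.subtype _)) *
            minorDet B (Iᶜ.map (Function.Embedding.subtype _))
              (Jᶜ.map (Function.Embedding.subtype _)) := by
  simp only [minorDet_map_subtype]
  rw [Matrix.adjugate_fin_succ_eq_det_submatrix]
  congr 1
  exact det_add_submatrix_orderIso (A.submatrix Subtype.val Subtype.val)
    (B.submatrix Subtype.val Subtype.val) (succAboveOrderIso i) (succAboveOrderIso j)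

/-! ### Forms of degree `N - 1` -/

section Forms

variable {g : ℕ}

theorem mem_symPairs {p : Fin g × Fin g} : p ∈ symPairs g ↔ p.1 ≤ p.2 := by
  simp [symPairs, Prod.ext_iff]

theorem nodup_symPairs (g : ℕ) : (symPairs g).Nodup := by
  refine List.nodup_flatMap.2 ⟨fun i _ => ((List.nodup_finRange g).filter _).map
    (Prod.mk_right_injective i), (List.nodup_finRange g).imp fun hab => ?_⟩
  rw [Function.onFun, List.disjoint_left]
  intro p hp hq
  obtain ⟨_, _, rfl⟩ := List.mem_map.1 hp
  obtain ⟨_, _, h⟩ := List.mem_map.1 hq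
  exact hab (Prod.mk.inj h).1.symm

theorem coordVec_comm (i j : Fin g) : coordVec i j = coordVec j i := by
  ext a b
  simp only [coordVec, Matrix.of_apply, or_comm]

theorem isSymm_coordVec (i j : Fin g) : (coordVec i j).IsSymm := by
  ext a b
  simp only [coordVec, Matrix.transpose_apply, Matrix.of_apply, or_comm, and_comm]

theorem coordVec_apply_of_le {i j h k : Fin g} (hij : i ≤ j) (hhk : h ≤ k) :
    coordVec i j h k = if (h, k) = (i, j) then 1 else 0 := by
  simp only [coordVec, Matrix.of_apply, Prod.mk.injEq]
  congr 1
  grind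

theorem half_mul_trace_mul_coordVec {M : Matrix (Fin g) (Fin g) ℂ} (hM : M.IsSymm)
    (i j : Fin g) :
    (1 + if i = j then 1 else 0) / 2 * (M * coordVec i j).trace = M i j := by
  by_cases hij : i = j
  · subst hij
    have hsingle : coordVec i i = Matrix.single i i 1 := by
      ext a b
      simp only [coordVec, Matrix.of_apply, Matrix.single_apply, or_self, eq_comm]
    rw [hsingle, Matrix.trace_mul_single]
    simp
  · have hsingle : coordVec i j = Matrix.single i j 1 + Matrix.single j i 1 := by
      ext a b
      simp only [coordVec, Matrix.add_apply, Matrix.of_apply, Matrix.single_apply]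
      grind
    rw [hsingle, mul_add, Matrix.trace_add, Matrix.trace_mul_single, Matrix.trace_mul_single,
      hM.apply i j, if_neg hij, MulOpposite.op_one, one_smul]
    ring

theorem prod_map_dtau_eq_ιMulti (l : List (Fin g × Fin g)) :
    (l.map dtau).prod = ExteriorAlgebra.ιMulti ℂ l.length
      fun a => coord (l.get a).1 (l.get a).2 := by
  rw [ExteriorAlgebra.ιMulti_apply]
  conv_lhs => rw [← List.ofFn_get l, List.map_ofFn]
  rfl

theorem ιMulti_ne_zero_of_apply_ne_zero {R M N : Type*} [CommRing R] [AddCommGroup M] [Module R M]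
    [AddCommGroup N] [Module R N] {n : ℕ} {f : M [⋀^Fin n]→ₗ[R] N} {v : Fin n → M}
    (hf : f v ≠ 0) : ExteriorAlgebra.ιMulti R n v ≠ 0 := by
  contrapose! hf
  have hv : exteriorPower.ιMulti R n v = 0 := Subtype.ext hf
  rw [← exteriorPower.alternatingMapLinearEquiv_apply_ιMulti, hv, map_zero]

theorem topForm_ne_zero (g : ℕ) : topForm g ≠ 0 := by
  set L := symPairs g
  let eval : Module.Dual ℂ (symMatrices g) →ₗ[ℂ] (Fin L.length → ℂ) := LinearMap.pi fun b =>
    Module.Dual.eval ℂ _ ⟨coordVec (L.get b).1 (L.get b).2, isSymm_coordVec _ _⟩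
  have hdual : (fun a => eval (coord (L.get a).1 (L.get a).2)) = (1 : Matrix _ _ ℂ) := by
    ext a b
    have hle : ∀ c, (L.get c).1 ≤ (L.get c).2 := fun c => mem_symPairs.1 (L.get_mem c)
    have hinj := (List.nodup_iff_injective_get.1 (nodup_symPairs g)).eq_iff (a := a) (b := b)
    exact (coordVec_apply_of_le (hle b) (hle a)).trans (if_congr hinj rfl rfl)
  rw [topForm, prod_map_dtau_eq_ιMulti]
  refine ιMulti_ne_zero_of_apply_ne_zero (f := Matrix.detRowAlternating.compLinearMap eval) ?_
  have hdet : Matrix.det (fun a => eval (coord (L.get a).1 (L.get a).2)) ≠ 0 := by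
    rw [hdual, Matrix.det_one]
    exact one_ne_zero
  exact hdet

theorem prod_map_dtau_mul_of_mem {l : List (Fin g × Fin g)} {p : Fin g × Fin g} (hp : p ∈ l) :
    (l.map dtau).prod * dtau p = 0 := by
  rw [← sign_erase_mul_dtau l p hp, mul_assoc, dtau, ExteriorAlgebra.ι_sq_zero, mul_zero]

theorem dtauCheck_comm (i j : Fin g) : dtauCheck i j = dtauCheck j i := by
  rw [dtauCheck, dtauCheck, min_comm, max_comm]

theorem dtauCheck_mul_dtau_eq_smul (i j : Fin g) {h k : Fin g} (hhk : h ≤ k) :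
    dtauCheck i j * dtau (h, k) = coordVec i j h k • topForm g := by
  wlog hij : i ≤ j generalizing i j
  · rw [dtauCheck_comm, coordVec_comm]
    exact this j i (le_of_not_ge hij)
  rw [coordVec_apply_of_le hij hhk]
  split_ifs with heq
  · rw [heq, dtauCheck_mul_dtau i j hij, one_smul]
  · have hmem : (h, k) ∈ (symPairs g).erase (i, j) :=
      (nodup_symPairs g).mem_erase_iff.2 ⟨heq, mem_symPairs.2 hhk⟩
    rw [dtauCheck, min_eq_left hij, max_eq_right hij, mul_assoc, prod_map_dtau_mul_of_mem hmem,
      mul_zero, zero_smul]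

theorem traceForm_mul_dtau (B : Matrix (Fin g) (Fin g) ℂ) {h k : Fin g} (hhk : h ≤ k) :
    traceForm B * dtau (h, k) = (B * coordVec h k).trace • topForm g := by
  have hswap : ∀ i j, coordVec i j h k = coordVec h k j i := fun i j => by
    simp only [coordVec, Matrix.of_apply]
    congr 1
    grind
  simp only [traceForm, Finset.sum_mul, smul_mul_assoc, dtauCheck_mul_dtau_eq_smul _ _ hhk,
    Matrix.trace, Matrix.diag_apply, Matrix.mul_apply, Finset.sum_smul, smul_smul, hswap]

theorem traceForm_smul (c : ℂ) (B : Matrix (Fin g) (Fin g) ℂ) :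
    traceForm (c • B) = c • traceForm B := by
  simp only [traceForm, Matrix.smul_apply, smul_assoc, Finset.smul_sum]

theorem eq_of_traceForm_eq {B C : Matrix (Fin g) (Fin g) ℂ} (hB : B.IsSymm) (hC : C.IsSymm)
    (h : traceForm B = traceForm C) : B = C := by
  have hle : ∀ a b : Fin g, a ≤ b → B a b = C a b := fun a b hab => by
    have htrace : (B * coordVec a b).trace = (C * coordVec a b).trace := by
      refine smul_left_injective ℂ (topForm_ne_zero g) ?_
      simp only [← traceForm_mul_dtau _ hab, h]
    rw [← half_mul_trace_mul_coordVec hB, htrace, half_mul_trace_mul_coordVec hC]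
  ext a b
  rcases le_total a b with hab | hab
  · exact hle a b hab
  · rw [← hB.apply, ← hC.apply, hle b a hab]

end Forms

/-! ### Series of exponentials in `τ` -/

section ExpSeries

variable {g : ℕ}

/-- The exponential `exp (2πi tr (M τ))`, the summand of theta-like series. -/
def quadExp (M τ : Matrix (Fin g) (Fin g) ℂ) : ℂ :=
  Complex.exp (2 * Real.pi * Complex.I * (M * τ).trace)

theorem quadExp_add_smul (M τ V : Matrix (Fin g) (Fin g) ℂ) (t : ℂ) :
    quadExp M (τ + t • V) =
      Complex.exp (t * (2 * Real.pi * Complex.I * (M * V).trace)) * quadExp M τ := by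
  rw [quadExp, quadExp, ← Complex.exp_add, mul_add, Matrix.mul_smul, Matrix.trace_add,
    Matrix.trace_smul, smul_eq_mul]
  ring_nf

theorem quadExp_sum {ι : Type*} (s : Finset ι) (M : ι → Matrix (Fin g) (Fin g) ℂ)
    (τ : Matrix (Fin g) (Fin g) ℂ) : quadExp (∑ a ∈ s, M a) τ = ∏ a ∈ s, quadExp (M a) τ := by
  simp only [quadExp, Finset.sum_mul, Matrix.trace_sum, Finset.mul_sum, Complex.exp_sum]

/-- On the Siegel upper half-space the function `f` is the series `∑ w x * exp (2πi tr (M x τ))`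
over symmetric matrices `M x`, whose terms decay rapidly in a weight `N` that dominates the entries
of `M x`.  The derivatives `∂_{ij}` preserve series of this kind and act on them termwise. -/
structure HasExpSeries {X : Type*} (N : X → ℝ) (M : X → Matrix (Fin g) (Fin g) ℂ) (w : X → ℂ)
    (f : Matrix (Fin g) (Fin g) ℂ → ℂ) : Prop where
  isSymm : ∀ x, (M x).IsSymm
  isBigO : ∀ i j, (fun x => M x i j) =O[⊤] N
  rapidDecay : ∀ τ ∈ siegelUpperHalfSpace g, RapidDecay N fun x => w x * quadExp (M x) τ
  eq_tsum : ∀ τ ∈ siegelUpperHalfSpace g, f τ = ∑' x, w x * quadExp (M x) τ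

namespace HasExpSeries

variable {X : Type*} {N : X → ℝ} {M : X → Matrix (Fin g) (Fin g) ℂ} {w : X → ℂ}
  {f : Matrix (Fin g) (Fin g) ℂ → ℂ} {τ : Matrix (Fin g) (Fin g) ℂ}

theorem hasLineDerivAt (hf : HasExpSeries N M w f) (hτ : τ ∈ siegelUpperHalfSpace g)
    {V : Matrix (Fin g) (Fin g) ℂ} (hV : V.IsSymm) :
    HasLineDerivAt ℂ f
      (∑' x, 2 * Real.pi * Complex.I * (M x * V).trace * (w x * quadExp (M x) τ)) τ V := by
  have hb : (fun x => 2 * Real.pi * Complex.I * (M x * V).trace) =O[⊤] N := by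
    simp only [Matrix.trace, Matrix.diag_apply, Matrix.mul_apply, mul_comm _ (V _ _)]
    exact (Asymptotics.IsBigO.fun_sum fun i _ => Asymptotics.IsBigO.fun_sum fun j _ =>
      (hf.isBigO i j).const_mul_left _).const_mul_left _
  have hseries := (hf.rapidDecay τ hτ).hasLineDerivAt_tsum
    (e := fun x τ => w x * quadExp (M x) τ) (u := V) hb fun x t => by
      rw [quadExp_add_smul, mul_left_comm]
  refine HasDerivAt.congr_of_eventuallyEq hseries ?_
  filter_upwards [eventually_add_smul_mem_siegelUpperHalfSpace hτ hV] with t ht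
  exact hf.eq_tsum _ ht

theorem del (hf : HasExpSeries N M w f) (i j : Fin g) :
    HasExpSeries N M (fun x => 2 * Real.pi * Complex.I * M x i j * w x) (del i j f) where
  isSymm := hf.isSymm
  isBigO := hf.isBigO
  rapidDecay τ hτ := by
    simpa only [mul_assoc] using
      (hf.rapidDecay τ hτ).mul_of_isBigO ((hf.isBigO i j).const_mul_left (2 * Real.pi * Complex.I))
  eq_tsum τ hτ := by
    rw [SiegelTheta.del, (hf.hasLineDerivAt hτ (isSymm_coordVec i j)).lineDeriv, ← tsum_mul_left]
    refine tsum_congr fun x => ?_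
    rw [← half_mul_trace_mul_coordVec (hf.isSymm x) i j]
    ring

theorem foldr_del (hf : HasExpSeries N M w f) (l : List (Fin g × Fin g)) :
    HasExpSeries N M
      (fun x => (l.map fun p => 2 * Real.pi * Complex.I * M x p.1 p.2).prod * w x)
      (l.foldr (fun p F => SiegelTheta.del p.1 p.2 F) f) := by
  induction l with
  | nil => simpa using hf
  | cons p l ih =>
    simpa only [List.map_cons, List.prod_cons, List.foldr_cons, mul_assoc] using ih.del p.1 p.2

theorem pow (hf : HasExpSeries N M w f) (n : ℕ) :
    HasExpSeries (fun P : Fin n → X => ∑ a, |N (P a)|) (fun P => ∑ a, M (P a))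
      (fun P => ∏ a, w (P a)) (f ^ n) where
  isSymm P := by
    rw [Matrix.IsSymm, Matrix.transpose_sum]
    exact Finset.sum_congr rfl fun a _ => hf.isSymm (P a)
  isBigO i j := by
    simp only [Matrix.sum_apply]
    refine Asymptotics.IsBigO.fun_sum fun a _ => ?_
    refine ((hf.isBigO i j).comp_tendsto (k := fun P : Fin n → X => P a)
      Filter.tendsto_top).trans (Asymptotics.IsBigO.of_norm_le fun P => ?_)
    exact Finset.single_le_sum (f := fun a => |N (P a)|) (fun _ _ => abs_nonneg _)
      (Finset.mem_univ a)
  rapidDecay τ hτ := by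
    simpa only [quadExp_sum, Finset.prod_mul_distrib] using (hf.rapidDecay τ hτ).prod
  eq_tsum τ hτ := by
    simp only [quadExp_sum, ← Finset.prod_mul_distrib]
    rw [tsum_prod_pi fun _ => (hf.rapidDecay τ hτ).summable_norm, Finset.prod_const,
      Finset.card_fin, Pi.pow_apply, hf.eq_tsum τ hτ]

theorem delMinor_eq_tsum (hf : HasExpSeries N M w f) (hτ : τ ∈ siegelUpperHalfSpace g)
    (I J : Finset (Fin g)) :
    delMinor I J f τ =
      ∑' x, minorDet ((2 * Real.pi * Complex.I : ℂ) • M x) I J * (w x * quadExp (M x) τ) := by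
  by_cases h : J.card = I.card
  · simp only [delMinor, minorDet, dif_pos h, Matrix.det_apply', Finset.sum_mul]
    refine (HasSum.tsum_eq (hasSum_sum fun σ _ => ?_)).symm
    set l := List.ofFn fun a => (I.orderEmbOfFin rfl (σ a), J.orderEmbOfFin h a)
    have hl : (List.ofFn fun a => SiegelTheta.del (g := g) (I.orderEmbOfFin rfl (σ a))
        (J.orderEmbOfFin h a)) = l.map fun p => SiegelTheta.del p.1 p.2 := by
      rw [List.map_ofFn]; rfl
    have hsum := ((hf.foldr_del l).rapidDecay τ hτ).summable_norm.of_norm.hasSum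
    rw [← (hf.foldr_del l).eq_tsum τ hτ] at hsum
    rw [hl, List.foldr_map]
    simpa only [l, List.map_ofFn, List.prod_ofFn, Function.comp_apply, Matrix.submatrix_apply,
      Matrix.smul_apply, smul_eq_mul, mul_assoc] using hsum.mul_left ((Equiv.Perm.sign σ : ℤ) : ℂ)
  · simp only [delMinor, minorDet, dif_neg h, zero_mul, tsum_zero]

end HasExpSeries

/-- The minors of `∂` act on `f ^ n` at `τ` by
`|∂^I_J| (f ^ n) = n! / (n - k)! * f ^ (n - k) * det (∂_{ij} f)_{i ∈ I, j ∈ J}` with `k = #I`: no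
higher derivatives of `f` occur. -/
def MinorPowerRule (n : ℕ) (f : Matrix (Fin g) (Fin g) ℂ → ℂ) (τ : Matrix (Fin g) (Fin g) ℂ) :
    Prop :=
  ∀ I J : Finset (Fin g), delMinor I J (f ^ n) τ =
    n.descFactorial I.card * f τ ^ (n - I.card) * minorDet (delMatrix f τ) I J

theorem HasExpSeries.minorPowerRule {X : Type*} {N : X → ℝ} {q : X → Fin g → ℂ} {w : X → ℂ}
    {f : Matrix (Fin g) (Fin g) ℂ → ℂ} {τ : Matrix (Fin g) (Fin g) ℂ}
    (hf : HasExpSeries N (fun x => Matrix.vecMulVec (q x) (q x)) w f)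
    (hτ : τ ∈ siegelUpperHalfSpace g) (n : ℕ) : MinorPowerRule n f τ := by
  intro I J
  rw [(hf.pow n).delMinor_eq_tsum hτ]
  by_cases h : J.card = I.card
  swap
  · simp only [minorDet, dif_neg h, zero_mul, tsum_zero, mul_zero]
  set r := I.orderEmbOfFin rfl with hr
  set r' := J.orderEmbOfFin h with hr'
  set t : X → ℂ := fun x => w x * quadExp (Matrix.vecMulVec (q x) (q x)) τ
  have hdel : (delMatrix f τ).submatrix r r'
      = Matrix.of fun i j => ∑' x, 2 * Real.pi * Complex.I * q x (r i) * q x (r' j) * t x := by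
    ext i j
    refine ((hf.del (r i) (r' j)).eq_tsum τ hτ).trans (tsum_congr fun x => ?_)
    simp only [Matrix.vecMulVec_apply, t, mul_assoc]
  have hsum := hasSum_det_sum_vecMulVec_mul_prod (k := n)
    (x := fun x i => 2 * Real.pi * Complex.I * q x (r i)) (y := fun x j => q x (r' j)) (t := t)
    (fun i j => by
      simpa only [Matrix.vecMulVec_apply, mul_assoc] using
        ((hf.del (r i) (r' j)).rapidDecay τ hτ).summable_norm)
    (hf.rapidDecay τ hτ).summable_norm
  rw [Fintype.card_fin] at hsum
  rw [minorDet_eq _ rfl h, hdel, hf.eq_tsum τ hτ, ← hsum.tsum_eq]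
  refine tsum_congr fun P => ?_
  rw [minorDet_eq _ rfl h, quadExp_sum, ← Finset.prod_mul_distrib]
  congr 2
  ext i j
  simp only [Matrix.submatrix_apply, Matrix.smul_apply, Matrix.sum_apply, Matrix.vecMulVec_apply,
    smul_eq_mul, Finset.mul_sum, mul_assoc, ← hr, ← hr']

end ExpSeries

/-! ### Freitag's matrix of a pair of powers -/

section Freitag

theorem isSymm_delMatrix {g : ℕ} (f : Matrix (Fin g) (Fin g) ℂ → ℂ)
    (τ : Matrix (Fin g) (Fin g) ℂ) : (delMatrix f τ).IsSymm := by
  ext i j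
  simp only [delMatrix, Matrix.transpose_apply, Matrix.of_apply, del, coordVec_comm j i, eq_comm]

theorem isSymm_smul_delMatrix_sub {g : ℕ} (f h : Matrix (Fin g) (Fin g) ℂ → ℂ)
    (τ : Matrix (Fin g) (Fin g) ℂ) : (f τ • delMatrix h τ - h τ • delMatrix f τ).IsSymm :=
  ((isSymm_delMatrix h τ).smul _).sub ((isSymm_delMatrix f τ).smul _)

theorem descFactorial_mul_descFactorial_div_choose {K : Type*} [Field K] [CharZero K] {n k : ℕ}
    (hk : k ≤ n) :
    (n.descFactorial k * n.descFactorial (n - k) : K) / n.choose k = n.factorial := by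
  rw [div_eq_iff (Nat.cast_ne_zero.2 (Nat.choose_pos hk).ne')]
  have hfactorial := Nat.factorial_mul_descFactorial (Nat.sub_le n k)
  rw [Nat.sub_sub_self hk] at hfactorial
  rw [Nat.descFactorial_eq_factorial_mul_choose n k, ← hfactorial]
  push_cast
  ring

variable {n : ℕ} {f h : Matrix (Fin (n + 1)) (Fin (n + 1)) ℂ → ℂ}
  {τ : Matrix (Fin (n + 1)) (Fin (n + 1)) ℂ}

theorem freitagMatrix_pow (hf : MinorPowerRule n f τ) (hh : MinorPowerRule n h τ) :
    freitagMatrix (f ^ n) (h ^ n) τ =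
      (n.factorial : ℂ) • (f τ • delMatrix h τ - h τ • delMatrix f τ).adjugate := by
  ext i j
  have hsub : f τ • delMatrix h τ - h τ • delMatrix f τ
      = (-h τ) • delMatrix f τ + f τ • delMatrix h τ := by rw [neg_smul, neg_add_eq_sub]
  rw [Matrix.smul_apply, ← (isSymm_smul_delMatrix_sub f h τ).adjugate.apply, hsub,
    adjugate_add_apply, smul_eq_mul, mul_left_comm, freitagMatrix, Matrix.of_apply,
    Nat.add_sub_cancel, Finset.mul_sum _ _ (n.factorial : ℂ)]
  congr 1
  refine Finset.sum_congr rfl fun k hk => ?_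
  have hkn : k ≤ n := Nat.lt_succ_iff.1 (Finset.mem_range.1 hk)
  simp only [Finset.mul_sum]
  refine Finset.sum_congr rfl fun I hI => Finset.sum_congr rfl fun J _ => ?_
  have hI := (Finset.mem_powersetCard.1 hI).2
  have hIc : Iᶜ.card = n - k := card_compl_of_orderIso (succAboveOrderIso i) hI
  rw [hf, hh, minorDet_smul, minorDet_smul, Finset.card_map, Finset.card_map, hI, hIc,
    Nat.sub_sub_self hkn, neg_pow, ← descFactorial_mul_descFactorial_div_choose hkn]
  ring

theorem isSymm_freitagMatrix_pow (hf : MinorPowerRule n f τ) (hh : MinorPowerRule n h τ) :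
    (freitagMatrix (f ^ n) (h ^ n) τ).IsSymm := by
  rw [freitagMatrix_pow hf hh]
  exact (isSymm_smul_delMatrix_sub f h τ).adjugate.smul _

theorem delMatrix_div {g : ℕ} {f h : Matrix (Fin g) (Fin g) ℂ → ℂ} {τ : Matrix (Fin g) (Fin g) ℂ}
    (hf : ∀ i j, LineDifferentiableAt ℂ f τ (coordVec i j))
    (hh : ∀ i j, LineDifferentiableAt ℂ h τ (coordVec i j)) (h0 : h τ ≠ 0) :
    h τ ^ 2 • delMatrix (f / h) τ = h τ • delMatrix f τ - f τ • delMatrix h τ := by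
  ext i j
  have hdiv := HasDerivAt.div (hf i j).hasLineDerivAt (hh i j).hasLineDerivAt (by simpa using h0)
  simp only [zero_smul, add_zero] at hdiv
  have hline : lineDeriv ℂ (f / h) τ (coordVec i j) = _ := HasLineDerivAt.lineDeriv hdiv
  simp only [delMatrix, del, Matrix.smul_apply, Matrix.sub_apply, Matrix.of_apply, smul_eq_mul,
    hline]
  field_simp

end Freitag

/-! ### Theta constants -/

theorem summable_exp_neg_abs_int : Summable fun n : ℤ => Real.exp (-|(n : ℝ)|) :=
  Summable.of_nat_of_neg (by simpa using Real.summable_exp_neg_nat)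
    (by simpa using Real.summable_exp_neg_nat)

theorem summable_exp_neg_sq_add {c : ℝ} (hc : 0 < c) (S s : ℝ) :
    Summable fun n : ℤ => Real.exp (-c * (n + s) ^ 2 + S * |n + s|) := by
  set K := |s| + (S + 1) ^ 2 / (4 * c)
  refine (summable_exp_neg_abs_int.mul_left (Real.exp K)).of_nonneg_of_le
    (fun n => (Real.exp_pos _).le) fun n => ?_
  rw [← Real.exp_add, Real.exp_le_exp]
  have hshift : |(n : ℝ)| ≤ |n + s| + |s| := by simpa using abs_sub (n + s) s
  have hsquare : (S + 1) * |n + s| ≤ c * (n + s) ^ 2 + (S + 1) ^ 2 / (4 * c) := by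
    rw [← sub_nonneg, ← sq_abs (n + s)]
    have : c * |n + s| ^ 2 + (S + 1) ^ 2 / (4 * c) - (S + 1) * |n + s|
        = (2 * c * |n + s| - (S + 1)) ^ 2 / (4 * c) := by field_simp; ring
    rw [this]
    positivity
  linarith

section Theta

theorem im_ofReal_dotProduct {ι : Type*} [Fintype ι] (x : ι → ℝ) (z : ι → ℂ) :
    ((fun i => (x i : ℂ)) ⬝ᵥ z).im = x ⬝ᵥ fun i => (z i).im := by
  simp only [dotProduct, Complex.im_sum, Complex.im_ofReal_mul]

theorem im_ofReal_dotProduct_mulVec {ι : Type*} [Fintype ι] (x : ι → ℝ) (τ : Matrix ι ι ℂ) :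
    ((fun i => (x i : ℂ)) ⬝ᵥ τ.mulVec fun i => (x i : ℂ)).im
      = x ⬝ᵥ (τ.map Complex.im).mulVec x := by
  rw [im_ofReal_dotProduct]
  congr 1
  ext i
  rw [Matrix.mulVec, dotProduct_comm, im_ofReal_dotProduct, dotProduct_comm]
  rfl

variable {g : ℕ} (σ : Fin g → ZMod 2)

/-- The summation vector `p + σ / 2` of the theta series. -/
def charVec (p : Fin g → ℤ) (i : Fin g) : ℝ := p i + ((σ i).val : ℝ) / 2

theorem ofReal_charVec (p : Fin g → ℤ) :
    (fun i => (charVec σ p i : ℂ)) = (fun i => (p i : ℂ)) + halfChar σ := by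
  ext i
  simp only [charVec, halfChar, Pi.add_apply]
  push_cast
  rfl

/-- The weight `1 + |q|²` of `q = p + σ / 2`, which dominates both the entries of `q` and those of
`q qᵗ`. -/
def charWeight (p : Fin g → ℤ) : ℝ := 1 + charVec σ p ⬝ᵥ charVec σ p

theorem isBigO_charVec (i : Fin g) :
    (fun p => (charVec σ p i : ℂ)) =O[⊤] charWeight σ := by
  refine Asymptotics.IsBigO.of_norm_le fun p => ?_
  have hle := sq_apply_le_dotProduct_self (charVec σ p) i
  rw [Complex.norm_real, Real.norm_eq_abs, charWeight]
  nlinarith [sq_abs (charVec σ p i), sq_nonneg (|charVec σ p i| - 1)]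

theorem isBigO_charVec_mul_charVec (i j : Fin g) :
    (fun p => (charVec σ p i : ℂ) * charVec σ p j) =O[⊤] charWeight σ := by
  refine Asymptotics.IsBigO.of_norm_le fun p => ?_
  have hle := abs_mul_apply_le_dotProduct_self (charVec σ p) i j
  rw [← Complex.ofReal_mul, Complex.norm_real, Real.norm_eq_abs, charWeight]
  linarith

/-- The term `exp (2πi qᵗ τ q + 4πi qᵗ z)`, `q = p + σ / 2`, of the theta series of second order. -/
def thetaTerm (τ : Matrix (Fin g) (Fin g) ℂ) (z : Fin g → ℂ) (p : Fin g → ℤ) : ℂ :=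
  Complex.exp (2 * Real.pi * Complex.I *
      ((fun i => (charVec σ p i : ℂ)) ⬝ᵥ τ.mulVec fun i => (charVec σ p i : ℂ)) +
    4 * Real.pi * Complex.I * ((fun i => (charVec σ p i : ℂ)) ⬝ᵥ z))

theorem thetaTwo_eq_tsum (τ : Matrix (Fin g) (Fin g) ℂ) (z : Fin g → ℂ) :
    thetaTwo σ τ z = ∑' p, thetaTerm σ τ z p := by
  have hzero : halfChar (0 : Fin g → ZMod 2) = 0 := by
    ext i
    simp [halfChar]
  refine tsum_congr fun p => ?_
  rw [thetaTerm, ← ofReal_charVec, hzero, add_zero, Matrix.smul_mulVec, dotProduct_smul,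
    dotProduct_smul, smul_eq_mul, smul_eq_mul]
  ring_nf

theorem norm_thetaTerm (τ : Matrix (Fin g) (Fin g) ℂ) (z : Fin g → ℂ) (p : Fin g → ℤ) :
    ‖thetaTerm σ τ z p‖ = Real.exp
      (-(2 * Real.pi) * (charVec σ p ⬝ᵥ (τ.map Complex.im).mulVec (charVec σ p)) -
        4 * Real.pi * (charVec σ p ⬝ᵥ fun i => (z i).im)) := by
  have hre : ∀ (a : ℝ) (w : ℂ), (a * Real.pi * Complex.I * w).re = -(a * Real.pi) * w.im :=
    fun a w => by simp
  rw [thetaTerm, Complex.norm_exp, Complex.add_re, ← im_ofReal_dotProduct_mulVec,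
    ← im_ofReal_dotProduct]
  have h2 := hre 2
  have h4 := hre 4
  push_cast at h2 h4
  rw [h2, h4]
  ring_nf

theorem thetaTerm_add_smul_single (τ : Matrix (Fin g) (Fin g) ℂ) (z : Fin g → ℂ)
    (p : Fin g → ℤ) (i : Fin g) (t : ℂ) :
    thetaTerm σ τ (z + t • Pi.single i 1) p =
      Complex.exp (t * (4 * Real.pi * Complex.I * charVec σ p i)) * thetaTerm σ τ z p := by
  rw [thetaTerm, thetaTerm, ← Complex.exp_add, dotProduct_add, dotProduct_smul,
    dotProduct_single_one, smul_eq_mul]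
  ring_nf

theorem quadExp_vecMulVec_charVec (τ : Matrix (Fin g) (Fin g) ℂ) (p : Fin g → ℤ) :
    quadExp (Matrix.vecMulVec (fun i => (charVec σ p i : ℂ)) fun i => (charVec σ p i : ℂ)) τ
      = thetaTerm σ τ 0 p := by
  rw [quadExp, thetaTerm, dotProduct_zero, mul_zero, add_zero, Matrix.vecMulVec_mul,
    Matrix.trace_vecMulVec, dotProduct_comm, Matrix.dotProduct_mulVec]

theorem summable_exp_neg_dotProduct_add {c : ℝ} (hc : 0 < c) (y : Fin g → ℝ) :
    Summable fun p : Fin g → ℤ => Real.exp (-c * (charVec σ p ⬝ᵥ charVec σ p) +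
      ∑ i, y i * |charVec σ p i|) := by
  refine (summable_norm_prod_pi fun i => (summable_exp_neg_sq_add hc (y i)
    (((σ i).val : ℝ) / 2)).norm).congr fun p => ?_
  rw [norm_prod, dotProduct, Finset.mul_sum, ← Finset.sum_add_distrib, Real.exp_sum]
  simp only [Real.norm_of_nonneg (Real.exp_nonneg _), pow_two, charVec]

variable {σ} {τ : Matrix (Fin g) (Fin g) ℂ}

theorem rapidDecay_thetaTerm (hτ : τ ∈ siegelUpperHalfSpace g) (z : Fin g → ℂ) :
    RapidDecay (charWeight σ) (thetaTerm σ τ z) := by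
  obtain ⟨c, hc, hle⟩ := exists_pos_mul_dotProduct_self_le hτ.2
  have hpc : 0 < Real.pi * c := by positivity
  refine ⟨Real.pi * c, hpc, ((summable_exp_neg_dotProduct_add σ hpc
    fun i => 4 * Real.pi * |(z i).im|).mul_left (Real.exp (Real.pi * c))).of_nonneg_of_le
      (fun p => by positivity) fun p => ?_⟩
  set q := charVec σ p
  have hquad := mul_le_mul_of_nonneg_left (hle q) Real.two_pi_pos.le
  have hlin : -(4 * Real.pi * (q ⬝ᵥ fun i => (z i).im)) ≤
      ∑ i, 4 * Real.pi * |(z i).im| * |q i| := by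
    rw [dotProduct, Finset.mul_sum, ← Finset.sum_neg_distrib]
    refine Finset.sum_le_sum fun i _ => ?_
    calc -(4 * Real.pi * (q i * (z i).im)) = 4 * Real.pi * -(q i * (z i).im) := by ring
      _ ≤ 4 * Real.pi * (|q i| * |(z i).im|) := by
        rw [← abs_mul]
        gcongr
        exact neg_le_abs _
      _ = 4 * Real.pi * |(z i).im| * |q i| := by ring
  have hweight : |charWeight σ p| = 1 + q ⬝ᵥ q := abs_of_nonneg <|
    add_nonneg zero_le_one (Finset.sum_nonneg fun i _ => mul_self_nonneg _)
  rw [norm_thetaTerm, ← Real.exp_add, ← Real.exp_add, Real.exp_le_exp, hweight]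
  linarith

variable (σ) in
theorem hasExpSeries_thetaConst :
    HasExpSeries (charWeight σ) (fun p => Matrix.vecMulVec (fun i => (charVec σ p i : ℂ))
      fun i => (charVec σ p i : ℂ)) 1 (thetaConst σ) where
  isSymm p := Matrix.transpose_vecMulVec _ _
  isBigO := isBigO_charVec_mul_charVec σ
  rapidDecay τ hτ := by
    simpa only [quadExp_vecMulVec_charVec, Pi.one_apply, one_mul] using rapidDecay_thetaTerm hτ 0
  eq_tsum τ _ := by
    simp only [quadExp_vecMulVec_charVec, Pi.one_apply, one_mul, thetaConst, thetaTwo_eq_tsum]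

theorem dz_thetaTwo (hτ : τ ∈ siegelUpperHalfSpace g) (j : Fin g) (z : Fin g → ℂ) :
    dz j (thetaTwo σ τ) z
      = ∑' p, 4 * Real.pi * Complex.I * charVec σ p j * thetaTerm σ τ z p := by
  rw [dz, funext (thetaTwo_eq_tsum σ τ)]
  exact ((rapidDecay_thetaTerm hτ z).hasLineDerivAt_tsum
    (e := fun p z => thetaTerm σ τ z p) ((isBigO_charVec σ j).const_mul_left _)
    fun p t => thetaTerm_add_smul_single σ τ z p j t).lineDeriv

theorem dz_dz_thetaTwo (hτ : τ ∈ siegelUpperHalfSpace g) (i j : Fin g) :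
    dz i (dz j (thetaTwo σ τ)) 0 = 8 * Real.pi * Complex.I * del i j (thetaConst σ) τ := by
  have hdecay := (rapidDecay_thetaTerm (σ := σ) hτ 0).mul_of_isBigO
    ((isBigO_charVec σ j).const_mul_left (4 * Real.pi * Complex.I))
  have hdz := (hdecay.hasLineDerivAt_tsum (u := Pi.single i 1)
    (e := fun p z => 4 * Real.pi * Complex.I * charVec σ p j * thetaTerm σ τ z p)
    ((isBigO_charVec σ i).const_mul_left (4 * Real.pi * Complex.I)) fun p t => by
      rw [thetaTerm_add_smul_single, mul_left_comm]).lineDeriv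
  rw [funext (dz_thetaTwo hτ j), dz, hdz, ((hasExpSeries_thetaConst σ).del i j).eq_tsum τ hτ,
    ← tsum_mul_left]
  refine tsum_congr fun p => ?_
  rw [quadExp_vecMulVec_charVec, Matrix.vecMulVec_apply, Pi.one_apply]
  ring

variable (σ) in
theorem minorPowerRule_thetaConst (n : ℕ) (hτ : τ ∈ siegelUpperHalfSpace g) :
    MinorPowerRule n (thetaConst σ) τ :=
  (hasExpSeries_thetaConst σ).minorPowerRule hτ n

variable (ε δ : Fin g → ZMod 2)

theorem thetaA_eq_two_smul_thetaADel (hτ : τ ∈ siegelUpperHalfSpace g) :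
    thetaA ε δ τ = (2 : ℂ) • thetaADel ε δ τ := by
  ext i j
  simp only [thetaA, thetaADel, delMatrix, Matrix.smul_apply, Matrix.sub_apply, Matrix.of_apply,
    smul_eq_mul, dz_dz_thetaTwo hτ]
  ring

theorem thetaADel_eq_neg_smul_delMatrix_div (hτ : τ ∈ siegelUpperHalfSpace g)
    (hδ : thetaConst δ τ ≠ 0) :
    thetaADel ε δ τ = -((4 * Real.pi * Complex.I * thetaConst δ τ ^ 2 : ℂ) •
      delMatrix (thetaConst ε / thetaConst δ) τ) := by
  have hdiff : ∀ σ i j, LineDifferentiableAt ℂ (thetaConst σ) τ (coordVec i j) := fun σ i j =>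
    ((hasExpSeries_thetaConst σ).hasLineDerivAt hτ (isSymm_coordVec i j)).lineDifferentiableAt
  rw [mul_smul, delMatrix_div (hdiff ε) (hdiff δ) hδ, thetaADel, ← smul_neg, neg_sub]

theorem adjugate_thetaADel {n : ℕ} (ε δ : Fin (n + 1) → ZMod 2)
    {τ : Matrix (Fin (n + 1)) (Fin (n + 1)) ℂ} (hτ : τ ∈ siegelUpperHalfSpace (n + 1)) :
    (thetaADel ε δ τ).adjugate = ((4 * Real.pi * Complex.I) ^ n / (n.factorial : ℂ)) •
      freitagMatrix (thetaConst ε ^ n) (thetaConst δ ^ n) τ := by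
  rw [freitagMatrix_pow (minorPowerRule_thetaConst ε n hτ) (minorPowerRule_thetaConst δ n hτ),
    thetaADel, Matrix.adjugate_smul, Fintype.card_fin, Nat.add_sub_cancel, smul_smul,
    div_mul_cancel₀ _ (Nat.cast_ne_zero.2 n.factorial_ne_zero)]

theorem adjugate_thetaA {n : ℕ} (ε δ : Fin (n + 1) → ZMod 2)
    {τ : Matrix (Fin (n + 1)) (Fin (n + 1)) ℂ} (hτ : τ ∈ siegelUpperHalfSpace (n + 1)) :
    (thetaA ε δ τ).adjugate = ((8 * Real.pi * Complex.I) ^ n / (n.factorial : ℂ)) •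
      freitagMatrix (thetaConst ε ^ n) (thetaConst δ ^ n) τ := by
  have hpow : (8 * Real.pi * Complex.I) ^ n = 2 ^ n * (4 * Real.pi * Complex.I) ^ n := by
    rw [← mul_pow]
    ring
  rw [thetaA_eq_two_smul_thetaADel ε δ hτ, Matrix.adjugate_smul, Fintype.card_fin,
    Nat.add_sub_cancel, adjugate_thetaADel ε δ hτ, smul_smul, hpow, mul_div_assoc]

end Theta

end SiegelTheta

end

theorem mainTheorem3 (g : ℕ) (hg : 2 ≤ g) (ε δ : Fin g → ZMod 2) (hεδ : ε ≠ δ) :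
    -- Freitag's matrix is a symmetric matrix `B` with `{Θ[ε]^(g-1), Θ[δ]^(g-1)} = tr (B dτ̌)` ...
    ((∀ τ ∈ SiegelTheta.siegelUpperHalfSpace g,
        (SiegelTheta.freitagMatrix (SiegelTheta.thetaConst ε ^ (g - 1))
          (SiegelTheta.thetaConst δ ^ (g - 1)) τ).IsSymm ∧
        SiegelTheta.freitagPairing (SiegelTheta.thetaConst ε ^ (g - 1))
            (SiegelTheta.thetaConst δ ^ (g - 1)) τ =
          SiegelTheta.traceForm (SiegelTheta.freitagMatrix (SiegelTheta.thetaConst ε ^ (g - 1))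
            (SiegelTheta.thetaConst δ ^ (g - 1)) τ))) ∧
    -- ... and for every such `B`:
    ∀ B : Matrix (Fin g) (Fin g) ℂ → Matrix (Fin g) (Fin g) ℂ,
      (∀ τ ∈ SiegelTheta.siegelUpperHalfSpace g, (B τ).IsSymm) →
      (∀ τ ∈ SiegelTheta.siegelUpperHalfSpace g,
        SiegelTheta.freitagPairing (SiegelTheta.thetaConst ε ^ (g - 1))
          (SiegelTheta.thetaConst δ ^ (g - 1)) τ = SiegelTheta.traceForm (B τ)) →
      ∀ τ ∈ SiegelTheta.siegelUpperHalfSpace g,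
        -- the identity for `A = 4πi (Θ[ε] ∂Θ[δ] - Θ[δ] ∂Θ[ε])`
        (SiegelTheta.thetaADel ε δ τ).adjugate =
          ((4 * Real.pi * Complex.I) ^ (g - 1) / ((g - 1).factorial : ℂ)) • B τ ∧
        -- this matrix in terms of second derivatives in `z`, and the identity in these terms
        SiegelTheta.thetaA ε δ τ = (2 : ℂ) • SiegelTheta.thetaADel ε δ τ ∧
        (SiegelTheta.thetaA ε δ τ).adjugate =
          ((8 * Real.pi * Complex.I) ^ (g - 1) / ((g - 1).factorial : ℂ)) • B τ ∧
        -- this matrix in terms of the derivative of the quotient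
        (SiegelTheta.thetaConst δ τ ≠ 0 →
          SiegelTheta.thetaADel ε δ τ =
            -((4 * Real.pi * Complex.I * SiegelTheta.thetaConst δ τ ^ 2 : ℂ) •
              SiegelTheta.delMatrix (SiegelTheta.thetaConst ε / SiegelTheta.thetaConst δ) τ)) ∧
        -- equality of the differential forms
        SiegelTheta.traceForm (SiegelTheta.thetaADel ε δ τ).adjugate =
          ((4 * Real.pi * Complex.I) ^ (g - 1) / ((g - 1).factorial : ℂ)) •
            SiegelTheta.freitagPairing (SiegelTheta.thetaConst ε ^ (g - 1))
              (SiegelTheta.thetaConst δ ^ (g - 1)) τ := by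
  obtain ⟨n, rfl⟩ : ∃ n, g = n + 1 := ⟨g - 1, by omega⟩
  simp only [Nat.add_sub_cancel]
  have hsymm : ∀ τ ∈ SiegelTheta.siegelUpperHalfSpace (n + 1), (SiegelTheta.freitagMatrix
      (SiegelTheta.thetaConst ε ^ n) (SiegelTheta.thetaConst δ ^ n) τ).IsSymm := fun τ hτ =>
    SiegelTheta.isSymm_freitagMatrix_pow (SiegelTheta.minorPowerRule_thetaConst ε n hτ)
      (SiegelTheta.minorPowerRule_thetaConst δ n hτ)
  refine ⟨fun τ hτ => ⟨hsymm τ hτ, rfl⟩, fun B hB hpairing τ hτ => ?_⟩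
  have hfreitag : SiegelTheta.freitagMatrix (SiegelTheta.thetaConst ε ^ n)
      (SiegelTheta.thetaConst δ ^ n) τ = B τ :=
    SiegelTheta.eq_of_traceForm_eq (hsymm τ hτ) (hB τ hτ) (hpairing τ hτ)
  refine ⟨hfreitag ▸ SiegelTheta.adjugate_thetaADel ε δ hτ,
    SiegelTheta.thetaA_eq_two_smul_thetaADel ε δ hτ,
    hfreitag ▸ SiegelTheta.adjugate_thetaA ε δ hτ,
    SiegelTheta.thetaADel_eq_neg_smul_delMatrix_div ε δ hτ, ?_⟩
  rw [SiegelTheta.adjugate_thetaADel ε δ hτ, SiegelTheta.traceForm_smul, hpairing τ hτ, hfreitag]
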